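/- Let $M$ be an $n$-dimensional smooth manifold and $F:TM\to[0,\infty)$ a Finsler metric: $F$ is continuous, $C^\infty$ on $TM\setminus\{0\}$, satisfies $F(tu)=tF(u)$ for $t\ge 0$, and for $y\in T_xM\setminus\{0\}$ the form $g_y(u,v)=\frac12\frac{\partial^2}{\partial s\,\partial t}F^2(x,y+su+tv)\big|_{s=t=0}$ is positive definite. Geodesics are the smooth curves, with nowhere vanishing velocity $T$, that satisfy $D_TT=0$ with reference vector $T$, i.e. $\ddot\sigma^i+\Gamma^i_{jk}(\sigma,\dot\sigma)\dot\sigma^j\dot\sigma^k=0$ in local coordinates, where $\Gamma^i_{jk}$ are the coefficients of the Chern connection. An isometry of $(M,F)$ is a diffeomorphism whose differential preserves $F$. $(M,F)$ is called a geodesic orbit (g.o.) space if there is a group $G$ of isometries acting transitively on $M$ such that every geodesic is of the form $t\mapsto\varphi_t(p)$, where $p\in M$ and $(\varphi_t)_{t\in\mathbb R}$ is a one-parameter subgroup of $G$ (a homomorphism $\mathbb R\to G$ with $(t,x)\mapsto\varphi_t(x)$ smooth, i.e. $\varphi_t=\exp(tX)$ with $X$ in the Lie algebra of $G$ when $G$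 is a Lie group of transformations). For a basis $e_1,\dots,e_n$ of $T_xM$ put $\sigma(x)=\mathrm{Vol}(B^n)/\mathrm{Vol}\{(y^i)\in\mathbb R^n: F(y^ie_i)<1\}$, the density of the Busemann volume form ($B^n$ is the Euclidean unit ball and $\mathrm{Vol}$ the Euclidean volume), and for $y\in T_xM\setminus\{0\}$ let $\tau(x,y)=\ln\frac{\sqrt{\det (g_y(e_i,e_j))}}{\sigma(x)}$ be the distortion, which does not depend on the basis. The S-curvature for the Busemann volume form is $\mathbf S(x,y)=\frac{d}{dt}\big|_{t=0}\tau(c(t),\dot c(t))$, where $c$ is the geodesic with $c(0)=x$ and $\dot c(0)=y$. **Corollary 5.3.** If $(M,F)$ is a g.o. Finsler space, then $\mathbf S(x,y)=0$ for all $x\in M$ and $y\in T_xM\setminus\{0\}$; that is, for every such $(x,y)$ there is a geodesic $c$, defined near $t=0$, with $c(0)=x$ and $\dot c(0)=y$, and for every such geodesic $\tau(c(t),\dot c(t))$ is differentiable at $t=0$ with derivative $0$. -/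

import Mathlib

open scoped Manifold ContDiff

noncomputable section

/-- A Finsler metric on an `n`-dimensional smooth manifold `M`, as a function on the tangent bundle:
continuous with values in `[0, ∞)`, smooth off the zero section, positively homogeneous of degree
one on each tangent space, and with positive definite fundamental form
`g_y(u, u) = ½ ∂²/∂s∂t F²(x, y + s u + t u)` at `s = t = 0`, for `y ≠ 0`. -/
structure FinslerMetric (n : ℕ) (M : Type*) [TopologicalSpace M]
    [ChartedSpace (EuclideanSpace ℝ (Fin n)) M] [IsManifold (𝓡 n) ∞ M] where
  toFun : TangentBundle (𝓡 n) M → ℝ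
  continuous' : Continuous toFun
  nonneg' : ∀ v, 0 ≤ toFun v
  smooth' : ContMDiffOn (𝓡 n).tangent 𝓘(ℝ, ℝ) ∞ toFun {v | v.2 ≠ 0}
  homogeneous' : ∀ (x : M) (y : TangentSpace (𝓡 n) x) (t : ℝ), 0 ≤ t →
    toFun ⟨x, t • y⟩ = t * toFun ⟨x, y⟩
  posDef' : ∀ (x : M) (y u : TangentSpace (𝓡 n) x), y ≠ 0 → u ≠ 0 →
    0 < (1 / 2) * deriv (fun s : ℝ => deriv (fun t : ℝ => toFun ⟨x, y + s • u + t • u⟩ ^ 2) 0) 0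

namespace FinslerMetric

section Coordinates

variable {n : ℕ}

/-- The partial derivative `∂f/∂xⁱ` of a function `f (x, y)` on `ℝⁿ × ℝⁿ`. -/
def partialX (i : Fin n) (f : EuclideanSpace ℝ (Fin n) × EuclideanSpace ℝ (Fin n) → ℝ) :
    EuclideanSpace ℝ (Fin n) × EuclideanSpace ℝ (Fin n) → ℝ :=
  fun p => fderiv ℝ f p (EuclideanSpace.single i 1, 0)

/-- The partial derivative `∂f/∂yⁱ` of a function `f (x, y)` on `ℝⁿ × ℝⁿ`. -/
def partialY (i : Fin n) (f : EuclideanSpace ℝ (Fin n) × EuclideanSpace ℝ (Fin n) → ℝ) :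
    EuclideanSpace ℝ (Fin n) × EuclideanSpace ℝ (Fin n) → ℝ :=
  fun p => fderiv ℝ f p (0, EuclideanSpace.single i 1)

/-! In the definitions of this section `f (x, y)` stands for the expression of a Finsler metric in
natural coordinates of the tangent bundle. -/

/-- `g_{ij} = (½ F²)_{yⁱyʲ}`. -/
def coordMetric (f : EuclideanSpace ℝ (Fin n) × EuclideanSpace ℝ (Fin n) → ℝ) (i j : Fin n) :
    EuclideanSpace ℝ (Fin n) × EuclideanSpace ℝ (Fin n) → ℝ :=
  partialY i (partialY j (fun p => (1 / 2) * f p ^ 2))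

/-- `gⁱʲ`, the entries of the inverse of the matrix `(g_{ij})`. -/
def coordMetricInv (f : EuclideanSpace ℝ (Fin n) × EuclideanSpace ℝ (Fin n) → ℝ) (i j : Fin n) :
    EuclideanSpace ℝ (Fin n) × EuclideanSpace ℝ (Fin n) → ℝ :=
  fun p => ((Matrix.of fun k l => coordMetric f k l p)⁻¹ : Matrix (Fin n) (Fin n) ℝ) i j

/-- The Cartan tensor `C_{ijk} = ½ ∂g_{ij}/∂yᵏ = ¼ (F²)_{yⁱyʲyᵏ}`. -/
def coordCartan (f : EuclideanSpace ℝ (Fin n) × EuclideanSpace ℝ (Fin n) → ℝ) (i j k : Fin n) :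
    EuclideanSpace ℝ (Fin n) × EuclideanSpace ℝ (Fin n) → ℝ :=
  fun p => (1 / 2) * partialY k (coordMetric f i j) p

/-- The formal Christoffel symbols
`γⁱ_{jk} = ½ gⁱˢ (∂g_{sj}/∂xᵏ - ∂g_{jk}/∂xˢ + ∂g_{ks}/∂xʲ)`. -/
def formalChristoffel (f : EuclideanSpace ℝ (Fin n) × EuclideanSpace ℝ (Fin n) → ℝ)
    (i j k : Fin n) : EuclideanSpace ℝ (Fin n) × EuclideanSpace ℝ (Fin n) → ℝ :=
  fun p => (1 / 2) * ∑ s, coordMetricInv f i s p *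
    (partialX k (coordMetric f s j) p - partialX s (coordMetric f j k) p
      + partialX j (coordMetric f k s) p)

/-- The nonlinear connection `Nⁱ_j = γⁱ_{jk} yᵏ - gⁱˡ C_{ljk} γᵏ_{rs} yʳ yˢ`. -/
def nonlinearConnection (f : EuclideanSpace ℝ (Fin n) × EuclideanSpace ℝ (Fin n) → ℝ)
    (i j : Fin n) : EuclideanSpace ℝ (Fin n) × EuclideanSpace ℝ (Fin n) → ℝ :=
  fun p => (∑ k, formalChristoffel f i j k p * p.2 k) -
    ∑ l, ∑ k, ∑ r, ∑ s, coordMetricInv f i l p * coordCartan f l j k p *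
      formalChristoffel f k r s p * p.2 r * p.2 s

/-- The horizontal derivative `δ/δxᵏ = ∂/∂xᵏ - Nˢ_k ∂/∂yˢ`, applied to a function `h (x, y)`. -/
def horizontalDeriv (f : EuclideanSpace ℝ (Fin n) × EuclideanSpace ℝ (Fin n) → ℝ)
    (k : Fin n) (h : EuclideanSpace ℝ (Fin n) × EuclideanSpace ℝ (Fin n) → ℝ) :
    EuclideanSpace ℝ (Fin n) × EuclideanSpace ℝ (Fin n) → ℝ :=
  fun p => partialX k h p - ∑ s, nonlinearConnection f s k p * partialY s h p

/-- The Chern connection coefficients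
`Γⁱ_{jk} = ½ gⁱˢ (δg_{sj}/δxᵏ - δg_{jk}/δxˢ + δg_{ks}/δxʲ)`. -/
def chernCoeff (f : EuclideanSpace ℝ (Fin n) × EuclideanSpace ℝ (Fin n) → ℝ) (i j k : Fin n) :
    EuclideanSpace ℝ (Fin n) × EuclideanSpace ℝ (Fin n) → ℝ :=
  fun p => (1 / 2) * ∑ s, coordMetricInv f i s p *
    (horizontalDeriv f k (coordMetric f s j) p - horizontalDeriv f s (coordMetric f j k) p
      + horizontalDeriv f j (coordMetric f k s) p)

end Coordinates

variable {n : ℕ} {M : Type*} [TopologicalSpace M] [ChartedSpace (EuclideanSpace ℝ (Fin n)) M]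
  [IsManifold (𝓡 n) ∞ M]

/-- The fundamental tensor `g_y(u, v) = ½ ∂²/∂s∂t F²(x, y + s u + t v)` at `s = t = 0`. -/
def fundamentalTensor (F : FinslerMetric n M) {x : M} (y u v : TangentSpace (𝓡 n) x) : ℝ :=
  (1 / 2) * deriv (fun s : ℝ => deriv (fun t : ℝ => F.toFun ⟨x, y + s • u + t • v⟩ ^ 2) 0) 0

/-- The expression of `F` in the natural coordinates `(x, y)` of the tangent bundle induced by a
chart `e` of `M`. -/
def inCoordinates (F : FinslerMetric n M) (e : OpenPartialHomeomorph M (EuclideanSpace ℝ (Fin n))) :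
    EuclideanSpace ℝ (Fin n) × EuclideanSpace ℝ (Fin n) → ℝ :=
  fun p => F.toFun (tangentMap (𝓡 n) (𝓡 n) e.symm ⟨p.1, p.2⟩)

/-- The velocity `(γ(t), γ'(t))` of a curve, as a point of the tangent bundle. -/
def velocity (n : ℕ) {M : Type*} [TopologicalSpace M] [ChartedSpace (EuclideanSpace ℝ (Fin n)) M]
    (γ : ℝ → M) (t : ℝ) : TangentBundle (𝓡 n) M :=
  ⟨γ t, mfderiv 𝓘(ℝ, ℝ) (𝓡 n) γ t (1 : ℝ)⟩

/-- `γ` is a (constant speed) geodesic of `F` on the open interval `J`: a smooth curve with nowhere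
vanishing velocity `T` such that `D_T T = 0` with reference vector `T`, that is, in local
coordinates, `(γⁱ)'' + Γⁱ_{jk}(γ, γ') (γʲ)' (γᵏ)' = 0` with the Chern connection coefficients.
The vector `D_T T` does not depend on the coordinates, so the equation is asked for, at each time,
in some smooth chart around the point. -/
structure IsGeodesicOn (F : FinslerMetric n M) (γ : ℝ → M) (J : Set ℝ) : Prop where
  isOpen : IsOpen J
  ordConnected : J.OrdConnected
  smooth : ContMDiffOn 𝓘(ℝ, ℝ) (𝓡 n) ∞ γ J
  velocity_ne_zero : ∀ t ∈ J, (velocity n γ t).2 ≠ 0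
  equation : ∀ t ∈ J, ∃ e ∈ IsManifold.maximalAtlas (𝓡 n) ∞ M, γ t ∈ e.source ∧
    ∀ i : Fin n, deriv (deriv (fun r => e (γ r))) t i +
      ∑ j, ∑ k, chernCoeff (F.inCoordinates e) i j k (e (γ t), deriv (fun r => e (γ r)) t) *
        deriv (fun r => e (γ r)) t j * deriv (fun r => e (γ r)) t k = 0

/-- The group of isometries of `(M, F)`: the diffeomorphisms whose differential preserves `F`. -/
def isometryGroup (F : FinslerMetric n M) : Subgroup (Equiv.Perm M) where
  carrier := {φ | ContMDiff (𝓡 n) (𝓡 n) ∞ φ ∧ ContMDiff (𝓡 n) (𝓡 n) ∞ φ.symm ∧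
    ∀ v, F.toFun (tangentMap (𝓡 n) (𝓡 n) φ v) = F.toFun v}
  one_mem' := by
    refine ⟨contMDiff_id, contMDiff_id, fun v => ?_⟩
    have : ((1 : Equiv.Perm M) : M → M) = id := rfl
    rw [this, tangentMap_id]; rfl
  mul_mem' := by
    rintro a b ⟨ha, ha', hFa⟩ ⟨hb, hb', hFb⟩
    refine ⟨ha.comp hb, hb'.comp ha', fun v => ?_⟩
    have : ((a * b : Equiv.Perm M) : M → M) = a ∘ b := rfl
    rw [this, tangentMap_comp (ha.mdifferentiable (by simp)) (hb.mdifferentiable (by simp)),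
      Function.comp_apply, hFa, hFb]
  inv_mem' := by
    rintro a ⟨ha, ha', hFa⟩
    refine ⟨ha', ha, fun v => ?_⟩
    have h : (a : M → M) ∘ a.symm = id := by ext x; simp
    have h2 := tangentMap_comp (ha.mdifferentiable (by simp)) (ha'.mdifferentiable (by simp))
    rw [h, tangentMap_id] at h2
    have h3 := congrArg F.toFun (congrFun h2 v)
    rw [Function.comp_apply, hFa] at h3
    exact h3.symm

/-- A one-parameter subgroup of a group `G` of transformations of `M`: a homomorphism `t ↦ φ t`
from `(ℝ, +)` to `G` for which `(t, x) ↦ φ t x` is smooth. For a Lie group `G` of transformations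
these are the groups `t ↦ exp (t X)` with `X` in the Lie algebra of `G`. -/
structure IsOneParameterSubgroup (n : ℕ) {M : Type*} [TopologicalSpace M]
    [ChartedSpace (EuclideanSpace ℝ (Fin n)) M] (G : Subgroup (Equiv.Perm M))
    (φ : ℝ → Equiv.Perm M) : Prop where
  mem : ∀ t, φ t ∈ G
  map_add : ∀ s t, φ (s + t) = φ s * φ t
  smooth : ContMDiff (𝓘(ℝ, ℝ).prod (𝓡 n)) (𝓡 n) ∞ (fun p : ℝ × M => φ p.1 p.2)

/-- `(M, F)` is a geodesic orbit (g.o.) space: there is a group `G` of isometries, transitive on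
`M`, such that every geodesic is of the form `t ↦ φ t p` with `φ` a one-parameter subgroup of `G`
and `p` a point of `M`. -/
def IsGeodesicOrbit (F : FinslerMetric n M) : Prop :=
  ∃ G : Subgroup (Equiv.Perm M), G ≤ F.isometryGroup ∧ (∀ x y : M, ∃ a ∈ G, a x = y) ∧
    ∀ (γ : ℝ → M) (J : Set ℝ), F.IsGeodesicOn γ J →
      ∃ (φ : ℝ → Equiv.Perm M) (p : M), IsOneParameterSubgroup n G φ ∧ ∀ t ∈ J, γ t = φ t p

/-- The density `σ(x) = Vol(Bⁿ) / Vol {y ∈ ℝⁿ | F(x, yⁱ eᵢ) < 1}` of the Busemann volume form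
with respect to a basis `e` of the tangent space at `x`. -/
def busemannDensity (F : FinslerMetric n M) {x : M}
    (e : Module.Basis (Fin n) ℝ (TangentSpace (𝓡 n) x)) : ℝ :=
  MeasureTheory.volume.real (Metric.ball (0 : EuclideanSpace ℝ (Fin n)) 1) /
    MeasureTheory.volume.real {y : EuclideanSpace ℝ (Fin n) | F.toFun ⟨x, ∑ i, y i • e i⟩ < 1}

/-- The distortion `τ(x, y) = ln (√(det g_y(eᵢ, eⱼ)) / σ(x))` of the Busemann volume form, computed
in a basis `e` of the tangent space at `x`. -/
def distortion (F : FinslerMetric n M) {x : M}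
    (e : Module.Basis (Fin n) ℝ (TangentSpace (𝓡 n) x)) (y : TangentSpace (𝓡 n) x) : ℝ :=
  Real.log (√(Matrix.det (Matrix.of fun i j => F.fundamentalTensor y (e i) (e j))) /
    F.busemannDensity e)

/-- The S-curvature of `F` for the Busemann volume form exists at the tangent vector `v` and equals
`s`: there is a geodesic `c` with `c'(0) = v`, and for every such geodesic the distortion
`τ(c(t), c'(t))`, whatever bases of the tangent spaces it is computed in, has derivative `s` at
`t = 0`. -/
def HasSCurvatureAt (F : FinslerMetric n M) (v : TangentBundle (𝓡 n) M) (s : ℝ) : Prop :=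
  (∃ (c : ℝ → M) (J : Set ℝ), F.IsGeodesicOn c J ∧ 0 ∈ J ∧ velocity n c 0 = v) ∧
    ∀ (c : ℝ → M) (J : Set ℝ), F.IsGeodesicOn c J → 0 ∈ J → velocity n c 0 = v →
      ∀ e : ∀ x : M, Module.Basis (Fin n) ℝ (TangentSpace (𝓡 n) x),
        HasDerivAt (fun t => F.distortion (e (c t)) (velocity n c t).2) s 0

end FinslerMetric

end

open scoped Manifold ContDiff

noncomputable section

/-! The distortion is built from `F` on one tangent space and does not depend on the basis: under a
change of basis with matrix `P`, both the root of the Gram determinant and the Busemann density are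
multiplied by `|det P|`. An isometry `φ` restricts to linear isomorphisms of tangent spaces that
preserve `F`, so transporting the basis along `dφ` gives `τ(dφ w) = τ(w)` for `w ≠ 0`
(`distortion_tangentMap`).

In a g.o. space a geodesic is `c(t) = φ_t(p)`, and the group law gives `c(s) = φ_t(c(s - t))` for
`s` near `t`. Differentiating at `s = t` yields `c'(t) = dφ_t(c'(0))`. Hence `τ(c(t), c'(t))` is
constant and its derivative vanishes (`hasDerivAt_distortion_of_orbit`).

It remains to produce a geodesic with each nonzero initial velocity (`exists_isGeodesicOn`). In a
chart, strong convexity makes `(g_{ij})` invertible off the zero section, so the Chern coefficients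
are smooth there; Picard–Lindelöf applied to the first order system gives a solution, and a
bootstrap makes it smooth. -/

/-- The mixed second derivative of `h` along the plane `y + s u + t v`. -/
theorem deriv_deriv_eq_fderiv_fderiv {E : Type*} [NormedAddCommGroup E] [NormedSpace ℝ E]
    {h : E → ℝ} {y : E} (hh : ContDiffAt ℝ 2 h y) (u v : E) :
    deriv (fun s : ℝ => deriv (fun t : ℝ => h (y + s • u + t • v)) 0) 0
      = fderiv ℝ (fderiv ℝ h) y u v := by
  have hline : ∀ z w : E, HasDerivAt (fun t : ℝ => z + t • w) w 0 := fun z w => by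
    simpa using ((hasDerivAt_id (0 : ℝ)).smul_const w).const_add z
  have hd : ∀ᶠ z in nhds y, DifferentiableAt ℝ h z :=
    (hh.eventually (by simp)).mono fun z hz => hz.differentiableAt (by simp)
  have hcont : ContinuousAt (fun s : ℝ => y + s • u) 0 := (hline y u).continuousAt
  -- The inner derivative is identified only for small `s`, since `h` is known to be differentiable
  -- only near `y`; the outer derivative needs no more.
  have hev : (fun s : ℝ => deriv (fun t : ℝ => h (y + s • u + t • v)) 0) =ᶠ[nhds 0]
      fun s => fderiv ℝ h (y + s • u) v := by
    have : ∀ᶠ s : ℝ in nhds 0, DifferentiableAt ℝ h (y + s • u) := by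
      apply hcont.eventually; simpa using hd
    filter_upwards [this] with s hs
    have h1 : HasFDerivAt h (fderiv ℝ h (y + s • u)) ((y + s • u) + (0 : ℝ) • v) := by
      simpa using hs.hasFDerivAt
    exact (HasFDerivAt.comp_hasDerivAt (f := fun t : ℝ => (y + s • u) + t • v) (0 : ℝ) h1
      (hline (y + s • u) v)).deriv
  rw [hev.deriv_eq]
  have h2 : DifferentiableAt ℝ (fderiv ℝ h) y :=
    (hh.fderiv_right (m := 1) (by norm_num)).differentiableAt (by simp)
  have h3 : HasFDerivAt (fderiv ℝ h) (fderiv ℝ (fderiv ℝ h) y) (y + (0 : ℝ) • u) := by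
    simpa using h2.hasFDerivAt
  have h4 : HasDerivAt (fun s : ℝ => fderiv ℝ h (y + s • u)) (fderiv ℝ (fderiv ℝ h) y u) 0 :=
    HasFDerivAt.comp_hasDerivAt (f := fun t : ℝ => y + t • u) (0 : ℝ) h3 (hline y u)
  have h5 := h4.clm_apply (hasDerivAt_const (0 : ℝ) v)
  rw [h5.deriv, map_zero, add_zero]

namespace FinslerMetric

variable {n : ℕ} {M : Type*} [TopologicalSpace M] [ChartedSpace (EuclideanSpace ℝ (Fin n)) M]
  [IsManifold (𝓡 n) ∞ M]

/-! ### Independence of the distortion from the basis -/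

/-- The inclusion of a tangent space into the tangent bundle is smooth. -/
theorem contMDiff_tangentSpace_inclusion (x : M) :
    ContMDiff 𝓘(ℝ, EuclideanSpace ℝ (Fin n)) (𝓡 n).tangent ∞
      (fun w : EuclideanSpace ℝ (Fin n) => (⟨x, w⟩ : TangentBundle (𝓡 n) M)) := by
  intro w
  rw [Bundle.contMDiffAt_totalSpace]
  refine ⟨contMDiffAt_const, ?_⟩
  simp only [TangentBundle.trivializationAt_apply]
  rw [contMDiffAt_iff_contDiffAt]
  exact ContinuousLinearMap.contDiff _ |>.contDiffAt

theorem contDiffAt_fiber (F : FinslerMetric n M) (x : M) {y : EuclideanSpace ℝ (Fin n)}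
    (hy : y ≠ 0) :
    ContDiffAt ℝ ∞ (fun w : EuclideanSpace ℝ (Fin n) => F.toFun ⟨x, w⟩) y := by
  rw [← contMDiffAt_iff_contDiffAt]
  have h := F.smooth'.comp (contMDiff_tangentSpace_inclusion x).contMDiffOn
    (s := {w : EuclideanSpace ℝ (Fin n) | w ≠ 0}) (fun w hw => hw)
  exact h.contMDiffAt (isOpen_ne.mem_nhds hy)

/-- The fundamental tensor as a bilinear form. -/
theorem exists_bilin_fundamentalTensor (F : FinslerMetric n M) {x : M} {y : TangentSpace (𝓡 n) x}
    (hy : y ≠ 0) : ∃ B : LinearMap.BilinForm ℝ (TangentSpace (𝓡 n) x),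
      ∀ u v, F.fundamentalTensor y u v = B u v := by
  let h : EuclideanSpace ℝ (Fin n) → ℝ := fun w => F.toFun ⟨x, w⟩ ^ 2
  have hh : ContDiffAt ℝ 2 h y := ((F.contDiffAt_fiber x hy).pow 2).of_le (by norm_cast)
  let B : EuclideanSpace ℝ (Fin n) →L[ℝ] EuclideanSpace ℝ (Fin n) →L[ℝ] ℝ :=
    (1 / 2 : ℝ) • fderiv ℝ (fderiv ℝ h) y
  refine ⟨LinearMap.mk₂ ℝ (fun u v => B u v) (fun a b c => ?_) (fun c a b => ?_)
    (fun a b c => ?_) (fun c a b => ?_), fun u v => ?_⟩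
  · exact congrArg (fun L => L c) (B.map_add a b)
  · exact congrArg (fun L => L b) (B.map_smul c a)
  · exact (B a).map_add b c
  · exact (B a).map_smul c b
  · exact congrArg ((1 / 2 : ℝ) * ·) (deriv_deriv_eq_fderiv_fderiv hh u v)

/-- Gram matrices of one bilinear form are congruent through the base change matrix. Bilinearity of
`g_y` comes from the second differential of `F²` on the fibre, hence `y ≠ 0`. -/
theorem det_fundamentalTensor_basis_change (F : FinslerMetric n M) {x : M}
    {y : TangentSpace (𝓡 n) x} (hy : y ≠ 0)
    (e e' : Module.Basis (Fin n) ℝ (TangentSpace (𝓡 n) x)) :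
    (Matrix.of fun i j => F.fundamentalTensor y (e' i) (e' j)).det =
      (e.toMatrix e').det ^ 2 *
        (Matrix.of fun i j => F.fundamentalTensor y (e i) (e j)).det := by
  obtain ⟨B, hB⟩ := F.exists_bilin_fundamentalTensor hy
  have h1 : ∀ b : Module.Basis (Fin n) ℝ (TangentSpace (𝓡 n) x),
      (Matrix.of fun i j => F.fundamentalTensor y (b i) (b j)) = LinearMap.BilinForm.toMatrix b B := by
    intro b; ext i j; simp [hB, LinearMap.BilinForm.toMatrix_apply]
  rw [h1, h1, ← LinearMap.BilinForm.toMatrix_mul_basis_toMatrix e e' B, Matrix.det_mul, Matrix.det_mul,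
    Matrix.det_transpose]
  ring

theorem volume_unitBall_basis_change (F : FinslerMetric n M) {x : M}
    (e e' : Module.Basis (Fin n) ℝ (TangentSpace (𝓡 n) x)) :
    MeasureTheory.volume.real {y : EuclideanSpace ℝ (Fin n) | F.toFun ⟨x, ∑ i, y i • e' i⟩ < 1} =
      |(e.toMatrix e').det|⁻¹ * MeasureTheory.volume.real
        {y : EuclideanSpace ℝ (Fin n) | F.toFun ⟨x, ∑ i, y i • e i⟩ < 1} := by
  have hdet : (e.toMatrix e').det ≠ 0 := (Module.Basis.isUnit_det e e').ne_zero
  let b := (EuclideanSpace.basisFun (Fin n) ℝ).toBasis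
  -- `A` turns coordinates with respect to `e'` into coordinates with respect to `e`, so one unit
  -- ball is the preimage of the other and its volume scales by `|det A|⁻¹`.
  let A : EuclideanSpace ℝ (Fin n) →ₗ[ℝ] EuclideanSpace ℝ (Fin n) :=
    Matrix.toLin b b (e.toMatrix e')
  have hA : LinearMap.det A = (e.toMatrix e').det := LinearMap.det_toLin b _
  have hset : {y : EuclideanSpace ℝ (Fin n) | F.toFun ⟨x, ∑ i, y i • e' i⟩ < 1} =
      A ⁻¹' {y : EuclideanSpace ℝ (Fin n) | F.toFun ⟨x, ∑ i, y i • e i⟩ < 1} := by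
    ext y
    have : ∑ i, (A y) i • e i = ∑ i, y i • e' i := by
      have h1 : ∀ i, (A y) i = ∑ j, e.toMatrix e' i j * y j := by
        intro i
        have := congrFun (LinearMap.toMatrix_mulVec_repr b b A y) i
        rw [LinearMap.toMatrix_toLin] at this
        simpa [b, Matrix.mulVec, dotProduct] using this.symm
      simp only [h1, Finset.sum_smul]
      rw [Finset.sum_comm]
      refine Finset.sum_congr rfl fun j _ => ?_
      rw [← e.sum_toMatrix_smul_self e' j, Finset.smul_sum]
      simp [smul_smul, mul_comm]
    simp [this]
  rw [hset, MeasureTheory.measureReal_def, MeasureTheory.Measure.addHaar_preimage_linearMap _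
    (by rwa [hA]), ENNReal.toReal_mul, ENNReal.toReal_ofReal (abs_nonneg _), hA, abs_inv]
  rfl

theorem distortion_basis_change (F : FinslerMetric n M) {x : M}
    {y : TangentSpace (𝓡 n) x} (hy : y ≠ 0)
    (e e' : Module.Basis (Fin n) ℝ (TangentSpace (𝓡 n) x)) :
    F.distortion e' y = F.distortion e y := by
  have hdet : |(e.toMatrix e').det| ≠ 0 := abs_ne_zero.2 (Module.Basis.isUnit_det e e').ne_zero
  unfold distortion busemannDensity
  rw [F.det_fundamentalTensor_basis_change hy e e', F.volume_unitBall_basis_change e e',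
    Real.sqrt_mul (sq_nonneg _), Real.sqrt_sq_eq_abs]
  congr 1
  simp only [div_eq_mul_inv, mul_inv, inv_inv]
  field_simp

/-! ### Invariance under isometries and constancy along orbits -/

/-- The differential of an isometry at a point. -/
theorem exists_mfderiv_equiv_of_mem_isometryGroup (F : FinslerMetric n M) {φ : Equiv.Perm M}
    (hφ : φ ∈ F.isometryGroup) (x : M) :
    ∃ L : TangentSpace (𝓡 n) x ≃ₗ[ℝ] TangentSpace (𝓡 n) (φ x),
      ∀ w, L w = mfderiv (𝓡 n) (𝓡 n) φ x w := by
  obtain ⟨h1, h2, -⟩ := hφ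
  let d : Diffeomorph (𝓡 n) (𝓡 n) M M ∞ := ⟨φ, h1, h2⟩
  exact ⟨(d.mfderivToContinuousLinearEquiv (by simp) x).toLinearEquiv, fun w => rfl⟩

/-- The distortion is invariant under isometries. -/
theorem distortion_tangentMap (F : FinslerMetric n M) {φ : Equiv.Perm M}
    (hφ : φ ∈ F.isometryGroup) (e : ∀ x : M, Module.Basis (Fin n) ℝ (TangentSpace (𝓡 n) x))
    (w : TangentBundle (𝓡 n) M) (hw : w.2 ≠ 0) :
    F.distortion (e (tangentMap (𝓡 n) (𝓡 n) φ w).1) (tangentMap (𝓡 n) (𝓡 n) φ w).2 =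
      F.distortion (e w.1) w.2 := by
  obtain ⟨x, y⟩ := w
  obtain ⟨L, hL⟩ := F.exists_mfderiv_equiv_of_mem_isometryGroup hφ x
  have hF : ∀ w : TangentSpace (𝓡 n) x, F.toFun ⟨φ x, L w⟩ = F.toFun ⟨x, w⟩ := fun w => by
    rw [hL]; exact hφ.2.2 ⟨x, w⟩
  have hLy : (tangentMap (𝓡 n) (𝓡 n) φ ⟨x, y⟩).2 = L y := (hL y).symm
  have hy : L y ≠ 0 := by simpa using hw
  rw [hLy]
  change F.distortion (e (φ x)) (L y) = F.distortion (e x) y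
  -- The prescribed basis at `φ x` is unrelated to the one at `x`; replacing it by the image of the
  -- latter under `L` makes every ingredient agree term by term.
  rw [← F.distortion_basis_change hy (e (φ x)) ((e x).map L)]
  have h1 : ∀ u v, F.fundamentalTensor (L y) (L u) (L v) = F.fundamentalTensor y u v := by
    intro u v
    simp only [fundamentalTensor, ← map_smul, ← map_add, hF]
  unfold distortion busemannDensity
  simp only [Module.Basis.map_apply, h1, ← map_smul, ← map_sum, hF]

/-- Along an orbit of a one-parameter group of isometries the distortion is constant. -/
theorem hasDerivAt_distortion_of_orbit (F : FinslerMetric n M) {G : Subgroup (Equiv.Perm M)}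
    (hG : G ≤ F.isometryGroup) {φ : ℝ → Equiv.Perm M} (hφ : IsOneParameterSubgroup n G φ)
    {c : ℝ → M} {J : Set ℝ} (hc : F.IsGeodesicOn c J) (h0 : 0 ∈ J) {p : M}
    (hp : ∀ t ∈ J, c t = φ t p) (e : ∀ x : M, Module.Basis (Fin n) ℝ (TangentSpace (𝓡 n) x)) :
    HasDerivAt (fun t => F.distortion (e (c t)) (velocity n c t).2) 0 0 := by
  have hvel : ∀ t ∈ J, velocity n c t = tangentMap (𝓡 n) (𝓡 n) (φ t) (velocity n c 0) := by
    intro t ht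
    have hφt := hG (hφ.mem t)
    -- `φ_s = φ_t φ_{s - t}`; both `s` and `s - t` must lie in `J`, so the identity is local.
    have hev : c =ᶠ[nhds t] (φ t ∘ c) ∘ fun s => s - t := by
      have h1 : ∀ᶠ s in nhds t, s - t ∈ J := by
        have : ContinuousAt (fun s : ℝ => s - t) t := by fun_prop
        apply this.eventually_mem
        simpa using hc.isOpen.mem_nhds h0
      filter_upwards [hc.isOpen.mem_nhds ht, h1] with s hs hs'
      simp only [Function.comp_apply]
      rw [hp s hs, hp _ hs', ← Equiv.Perm.mul_apply, ← hφ.map_add, add_sub_cancel]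
    have hct : c t = φ t (c 0) := by
      rw [hp t ht, hp 0 h0, ← Equiv.Perm.mul_apply, ← hφ.map_add, add_zero]
    have hcd : MDifferentiableAt 𝓘(ℝ, ℝ) (𝓡 n) c 0 :=
      (hc.smooth.contMDiffAt (hc.isOpen.mem_nhds h0)).mdifferentiableAt (by simp)
    have hφd : MDifferentiable (𝓡 n) (𝓡 n) (φ t) := hφt.1.mdifferentiable (by simp)
    have hsub : HasMFDerivAt 𝓘(ℝ, ℝ) 𝓘(ℝ, ℝ) (fun s : ℝ => s - t) t
        (ContinuousLinearMap.id ℝ ℝ) := ((hasFDerivAt_id t).sub_const t).hasMFDerivAt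
    -- The chain rule places the base point at `t - t`; since tangent spaces depend on it, it is
    -- replaced by `0` only at the end.
    have hcd' : HasMFDerivAt 𝓘(ℝ, ℝ) (𝓡 n) c (t - t) (mfderiv 𝓘(ℝ, ℝ) (𝓡 n) c (t - t)) := by
      have : MDifferentiableAt 𝓘(ℝ, ℝ) (𝓡 n) c (t - t) := by rwa [sub_self]
      exact this.hasMFDerivAt
    have h2 := HasMFDerivAt.comp (f := fun s : ℝ => s - t) (g := φ t ∘ c) t
      ((hφd (c (t - t))).hasMFDerivAt.comp (t - t) hcd') hsub
    have h3 := (h2.congr_of_eventuallyEq hev).mfderiv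
    have h4 : velocity n c t = tangentMap (𝓡 n) (𝓡 n) (φ t) (velocity n c (t - t)) := by
      unfold velocity tangentMap
      have h5 : mfderiv 𝓘(ℝ, ℝ) (𝓡 n) c t (1 : ℝ) =
        mfderiv (𝓡 n) (𝓡 n) (φ t) (c (t - t)) (mfderiv 𝓘(ℝ, ℝ) (𝓡 n) c (t - t) (1 : ℝ)) := by
        rw [h3]; rfl
      simp only [h5]
      congr 1
      rw [hct, sub_self]
    rwa [sub_self] at h4
  have hconst : (fun t => F.distortion (e (c t)) (velocity n c t).2) =ᶠ[nhds 0]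
      fun _ => F.distortion (e (c 0)) (velocity n c 0).2 := by
    filter_upwards [hc.isOpen.mem_nhds h0] with t ht
    have h1 := F.distortion_tangentMap (hG (hφ.mem t)) e _ (hc.velocity_ne_zero 0 h0)
    rw [← hvel t ht] at h1
    exact h1
  exact (hasDerivAt_const _ _).congr_of_eventuallyEq hconst

end FinslerMetric

/-! ### Regularity of the geodesic equation in coordinates -/

/-- A solution of an autonomous differential equation with smooth right hand side is smooth. -/
theorem contDiffOn_of_hasDerivAt_comp {E : Type*} [NormedAddCommGroup E] [NormedSpace ℝ E]
    {f : E → E} {U : Set E} (hf : ContDiffOn ℝ ∞ f U) {α : ℝ → E} {J : Set ℝ} (hJ : IsOpen J)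
    (hU : Set.MapsTo α J U) (hα : ∀ t ∈ J, HasDerivAt α (f (α t)) t) : ContDiffOn ℝ ∞ α J := by
  rw [contDiffOn_infty]
  intro k
  -- Bootstrap: if `α` is `C^k`, then so is `α' = f ∘ α`, and `α` is `C^(k+1)`.
  induction k with
  | zero => exact contDiffOn_zero.2 fun t ht => (hα t ht).continuousAt.continuousWithinAt
  | succ k ih =>
    push_cast
    rw [contDiffOn_succ_iff_deriv_of_isOpen hJ]
    refine ⟨fun t ht => (hα t ht).differentiableAt.differentiableWithinAt, by simp, ?_⟩
    exact ((hf.of_le (by exact_mod_cast le_top)).comp ih hU).congr fun t ht => (hα t ht).deriv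

namespace FinslerMetric

section Coordinates

variable {n : ℕ} {f : EuclideanSpace ℝ (Fin n) × EuclideanSpace ℝ (Fin n) → ℝ}
  {p : EuclideanSpace ℝ (Fin n) × EuclideanSpace ℝ (Fin n)}

theorem contDiffAt_partialX (hf : ContDiffAt ℝ ∞ f p) (i : Fin n) :
    ContDiffAt ℝ ∞ (partialX i f) p :=
  (hf.fderiv_right (m := ∞) (by simp)).clm_apply contDiffAt_const

theorem contDiffAt_partialY (hf : ContDiffAt ℝ ∞ f p) (i : Fin n) :
    ContDiffAt ℝ ∞ (partialY i f) p :=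
  (hf.fderiv_right (m := ∞) (by simp)).clm_apply contDiffAt_const

theorem contDiffAt_coordMetric (hf : ContDiffAt ℝ ∞ f p) (i j : Fin n) :
    ContDiffAt ℝ ∞ (coordMetric f i j) p :=
  contDiffAt_partialY (contDiffAt_partialY (contDiffAt_const.mul (hf.pow 2)) j) i

theorem contDiffAt_det {E : Type*} [NormedAddCommGroup E] [NormedSpace ℝ E] {q : E}
    {A : E → Matrix (Fin n) (Fin n) ℝ} (hA : ∀ i j, ContDiffAt ℝ ∞ (fun q => A q i j) q) :
    ContDiffAt ℝ ∞ (fun q => (A q).det) q := by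
  simp only [Matrix.det_apply]
  refine ContDiffAt.sum fun σ _ => ?_
  refine ContDiffAt.const_smul _ ?_
  exact contDiffAt_prod fun i _ => hA _ _

/-- Cramer's rule: entries of the inverse are determinants of row-modified matrices divided by `det
A`. -/
theorem contDiffAt_inv_apply {E : Type*} [NormedAddCommGroup E] [NormedSpace ℝ E] {q : E}
    {A : E → Matrix (Fin n) (Fin n) ℝ} (hA : ∀ i j, ContDiffAt ℝ ∞ (fun q => A q i j) q)
    (hq : (A q).det ≠ 0) (i j : Fin n) : ContDiffAt ℝ ∞ (fun q => (A q)⁻¹ i j) q := by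
  simp only [Matrix.inv_def, Ring.inverse_eq_inv', Matrix.smul_apply, smul_eq_mul,
    Matrix.adjugate_apply]
  refine ((contDiffAt_det hA).inv hq).mul (contDiffAt_det fun k l => ?_)
  simp only [Matrix.updateRow_apply]
  split_ifs
  · exact contDiffAt_const
  · exact hA k l

theorem contDiffAt_coordMetricInv (hf : ContDiffAt ℝ ∞ f p)
    (hdet : (Matrix.of fun k l => coordMetric f k l p).det ≠ 0) (i j : Fin n) :
    ContDiffAt ℝ ∞ (coordMetricInv f i j) p :=
  contDiffAt_inv_apply (A := fun p => Matrix.of fun k l => coordMetric f k l p)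
    (fun k l => contDiffAt_coordMetric hf k l) hdet i j

theorem contDiffAt_fiberCoord (i : Fin n) :
    ContDiffAt ℝ ∞ (fun q : EuclideanSpace ℝ (Fin n) × EuclideanSpace ℝ (Fin n) => q.2 i) p :=
  ((EuclideanSpace.proj (𝕜 := ℝ) i).contDiff.comp contDiff_snd).contDiffAt

theorem contDiffAt_formalChristoffel (hf : ContDiffAt ℝ ∞ f p)
    (hdet : (Matrix.of fun k l => coordMetric f k l p).det ≠ 0) (i j k : Fin n) :
    ContDiffAt ℝ ∞ (formalChristoffel f i j k) p :=
  contDiffAt_const.mul <| ContDiffAt.sum fun _ _ => (contDiffAt_coordMetricInv hf hdet _ _).mul <|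
    ((contDiffAt_partialX (contDiffAt_coordMetric hf _ _) _).sub
      (contDiffAt_partialX (contDiffAt_coordMetric hf _ _) _)).add
      (contDiffAt_partialX (contDiffAt_coordMetric hf _ _) _)

theorem contDiffAt_nonlinearConnection (hf : ContDiffAt ℝ ∞ f p)
    (hdet : (Matrix.of fun k l => coordMetric f k l p).det ≠ 0) (i j : Fin n) :
    ContDiffAt ℝ ∞ (nonlinearConnection f i j) p := by
  refine ContDiffAt.sub (ContDiffAt.sum fun _ _ =>
    (contDiffAt_formalChristoffel hf hdet _ _ _).mul (contDiffAt_fiberCoord _)) ?_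
  refine ContDiffAt.sum fun _ _ => ContDiffAt.sum fun _ _ => ContDiffAt.sum fun _ _ =>
    ContDiffAt.sum fun _ _ => ?_
  exact ((((contDiffAt_coordMetricInv hf hdet _ _).mul
    (contDiffAt_const.mul (contDiffAt_partialY (contDiffAt_coordMetric hf _ _) _))).mul
    (contDiffAt_formalChristoffel hf hdet _ _ _)).mul (contDiffAt_fiberCoord _)).mul
    (contDiffAt_fiberCoord _)

theorem contDiffAt_horizontalDeriv (hf : ContDiffAt ℝ ∞ f p)
    (hdet : (Matrix.of fun k l => coordMetric f k l p).det ≠ 0) (k : Fin n)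
    {h : EuclideanSpace ℝ (Fin n) × EuclideanSpace ℝ (Fin n) → ℝ} (hh : ContDiffAt ℝ ∞ h p) :
    ContDiffAt ℝ ∞ (horizontalDeriv f k h) p :=
  (contDiffAt_partialX hh k).sub <| ContDiffAt.sum fun _ _ =>
    (contDiffAt_nonlinearConnection hf hdet _ _).mul (contDiffAt_partialY hh _)

theorem contDiffAt_chernCoeff (hf : ContDiffAt ℝ ∞ f p)
    (hdet : (Matrix.of fun k l => coordMetric f k l p).det ≠ 0) (i j k : Fin n) :
    ContDiffAt ℝ ∞ (chernCoeff f i j k) p :=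
  contDiffAt_const.mul <| ContDiffAt.sum fun _ _ => (contDiffAt_coordMetricInv hf hdet _ _).mul <|
    ((contDiffAt_horizontalDeriv hf hdet _ (contDiffAt_coordMetric hf _ _)).sub
      (contDiffAt_horizontalDeriv hf hdet _ (contDiffAt_coordMetric hf _ _))).add
      (contDiffAt_horizontalDeriv hf hdet _ (contDiffAt_coordMetric hf _ _))

/-- The first order system on `(x, y)` equivalent to the geodesic equation. -/
def geodesicField (f : EuclideanSpace ℝ (Fin n) × EuclideanSpace ℝ (Fin n) → ℝ) :
    EuclideanSpace ℝ (Fin n) × EuclideanSpace ℝ (Fin n) →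
      EuclideanSpace ℝ (Fin n) × EuclideanSpace ℝ (Fin n) :=
  fun p => (p.2, WithLp.toLp 2 fun i => -∑ j, ∑ k, chernCoeff f i j k p * p.2 j * p.2 k)

theorem contDiffAt_geodesicField (hf : ContDiffAt ℝ ∞ f p)
    (hdet : (Matrix.of fun k l => coordMetric f k l p).det ≠ 0) :
    ContDiffAt ℝ ∞ (geodesicField f) p := by
  refine contDiffAt_snd.prodMk ?_
  rw [contDiffAt_euclidean]
  intro i
  exact ContDiffAt.neg <| ContDiffAt.sum fun _ _ => ContDiffAt.sum fun _ _ =>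
    ((contDiffAt_chernCoeff hf hdet _ _ _).mul (contDiffAt_fiberCoord _)).mul
      (contDiffAt_fiberCoord _)

theorem coordMetric_eq_fderiv_fderiv (hf : ContDiffAt ℝ ∞ f p) (i j : Fin n) :
    coordMetric f i j p = fderiv ℝ (fderiv ℝ fun q => (1 / 2) * f q ^ 2) p
      (0, EuclideanSpace.single i 1) (0, EuclideanSpace.single j 1) := by
  have h1 : ContDiffAt ℝ ∞ (fun q => (1 / 2) * f q ^ 2) p := contDiffAt_const.mul (hf.pow 2)
  have h2 : DifferentiableAt ℝ (fderiv ℝ fun q => (1 / 2) * f q ^ 2) p :=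
    (h1.fderiv_right (m := ∞) (by simp)).differentiableAt (by simp)
  have h3 := (h2.hasFDerivAt.clm_apply
    (hasFDerivAt_const ((0, EuclideanSpace.single j 1) :
      EuclideanSpace ℝ (Fin n) × EuclideanSpace ℝ (Fin n)) p)).fderiv
  unfold coordMetric
  rw [partialY]
  unfold partialY
  rw [h3]
  simp

/-- The matrix `(g_{ij})` is invertible when `½ F²` has positive definite vertical Hessian. -/
theorem det_coordMetric_ne_zero (hf : ContDiffAt ℝ ∞ f p)
    (hpos : ∀ u : EuclideanSpace ℝ (Fin n), u ≠ 0 →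
      0 < fderiv ℝ (fderiv ℝ fun q => (1 / 2) * f q ^ 2) p (0, u) (0, u)) :
    (Matrix.of fun k l => coordMetric f k l p).det ≠ 0 := by
  intro h0
  -- A kernel vector `w` of a singular `(g_{ij})` would satisfy `wᵀ g w = 0`, against positivity of
  -- the vertical Hessian.
  obtain ⟨w, hw, hw0⟩ := Matrix.exists_mulVec_eq_zero_iff.2 h0
  let u : EuclideanSpace ℝ (Fin n) := WithLp.toLp 2 w
  have hu : u ≠ 0 := fun h => hw (congrArg WithLp.ofLp h)
  set B := fderiv ℝ (fderiv ℝ fun q => (1 / 2) * f q ^ 2) p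
  have hsum : ((0, u) : EuclideanSpace ℝ (Fin n) × EuclideanSpace ℝ (Fin n)) =
      ∑ i, w i • (0, EuclideanSpace.single i 1) := by
    refine Prod.ext ?_ ?_
    · simp [Prod.fst_sum]
    · ext k
      simp [Prod.snd_sum, u, Pi.single_apply]
  have hB : B (0, u) (0, u) = ∑ i, w i * ∑ j, coordMetric f i j p * w j := by
    conv_lhs => rw [hsum]
    simp only [map_sum, map_smul, sum_apply, smul_apply,
      smul_eq_mul, coordMetric_eq_fderiv_fderiv hf]
    simp only [Finset.mul_sum]
    rw [Finset.sum_comm]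
    refine Finset.sum_congr rfl fun i _ => Finset.sum_congr rfl fun j _ => ?_
    ring
  have h1 : ∀ i, ∑ j, coordMetric f i j p * w j = 0 := fun i => congrFun hw0 i
  have h2 := hpos u hu
  rw [hB] at h2
  simp [h1] at h2

end Coordinates

variable {n : ℕ} {M : Type*} [TopologicalSpace M] [ChartedSpace (EuclideanSpace ℝ (Fin n)) M]
  [IsManifold (𝓡 n) ∞ M]

/-! ### Existence of geodesics on the manifold -/

/-- Keeps nonzero coordinate vectors off the zero section, where smoothness and convexity of `F` are
not assumed. -/
theorem mfderiv_chart_symm_injective (x : M) {z : EuclideanSpace ℝ (Fin n)}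
    (hz : z ∈ (chartAt (EuclideanSpace ℝ (Fin n)) x).target) :
    Function.Injective
      (mfderiv (𝓡 n) (𝓡 n) (chartAt (EuclideanSpace ℝ (Fin n)) x).symm z) := by
  have : IsManifold (𝓡 n) 1 M := IsManifold.of_le (n := ∞) (by simp)
  exact (mdifferentiable_chart (I := 𝓡 n) x).symm.mfderiv_injective hz

theorem contDiffAt_inCoordinates_chartAt (F : FinslerMetric n M) (v : TangentBundle (𝓡 n) M)
    {p : EuclideanSpace ℝ (Fin n) × EuclideanSpace ℝ (Fin n)}
    (hp : p.1 ∈ (chartAt (EuclideanSpace ℝ (Fin n)) v.1).target) (hp2 : p.2 ≠ 0) :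
    ContDiffAt ℝ ∞ (F.inCoordinates (chartAt (EuclideanSpace ℝ (Fin n)) v.1)) p := by
  set e := chartAt (EuclideanSpace ℝ (Fin n)) v.1
  have : IsManifold (𝓡 n) 1 M := IsManifold.of_le (n := ∞) (by simp)
  let U : Set (EuclideanSpace ℝ (Fin n) × EuclideanSpace ℝ (Fin n)) := e.target ×ˢ {0}ᶜ
  have hU : IsOpen U := e.open_target.prod isOpen_compl_singleton
  let c := chartAt (ModelProd (EuclideanSpace ℝ (Fin n)) (EuclideanSpace ℝ (Fin n))) v
  -- The natural coordinates `(x, y)` are those of the tangent bundle chart, so smoothness of `F`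
  -- off the zero section transfers directly.
  have hc : ∀ q ∈ U, tangentMap (𝓡 n) (𝓡 n) e.symm ⟨q.1, q.2⟩ = c.symm q := fun q hq =>
    tangentMap_chart_symm (p := v) (q := ⟨q.1, q.2⟩) hq.1
  have h1 : ContMDiffOn (𝓡 n).tangent (𝓡 n).tangent ∞ c.symm c.target := contMDiffOn_chart_symm
  have h2 : ContMDiffOn (𝓡 n).tangent 𝓘(ℝ, ℝ) ∞ (fun q => F.toFun (c.symm q)) U := by
    refine F.smooth'.comp (h1.mono ?_) ?_
    · intro q hq
      exact (TangentBundle.mem_chart_target_iff q v).2 hq.1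
    · intro q hq
      change c.symm q ∈ {v : TangentBundle (𝓡 n) M | v.2 ≠ 0}
      rw [← hc q hq]
      intro h
      exact hq.2 (mfderiv_chart_symm_injective v.1 hq.1 (h.trans (map_zero _).symm))
  let g : EuclideanSpace ℝ (Fin n) × EuclideanSpace ℝ (Fin n) → ℝ := fun q => F.toFun (c.symm q)
  have h3 : ContDiffOn ℝ ∞ g U := by
    rw [← contMDiffOn_iff_contDiffOn, modelWithCornersSelf_prod]
    exact h2
  refine (h3.congr fun q hq => ?_).contDiffAt (hU.mem_nhds ⟨hp, hp2⟩)
  exact congrArg F.toFun (hc q hq)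

theorem det_coordMetric_inCoordinates_ne_zero (F : FinslerMetric n M)
    (v : TangentBundle (𝓡 n) M) {p : EuclideanSpace ℝ (Fin n) × EuclideanSpace ℝ (Fin n)}
    (hp : p.1 ∈ (chartAt (EuclideanSpace ℝ (Fin n)) v.1).target) (hp2 : p.2 ≠ 0) :
    (Matrix.of fun k l => coordMetric
      (F.inCoordinates (chartAt (EuclideanSpace ℝ (Fin n)) v.1)) k l p).det ≠ 0 := by
  have hf := F.contDiffAt_inCoordinates_chartAt v hp hp2
  refine det_coordMetric_ne_zero hf fun u hu => ?_
  set e := chartAt (EuclideanSpace ℝ (Fin n)) v.1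
  set f := F.inCoordinates e
  have h1 : ContDiffAt ℝ 2 (fun q => (1 / 2) * f q ^ 2) p :=
    (contDiffAt_const.mul (hf.pow 2)).of_le (by norm_cast)
  rw [← deriv_deriv_eq_fderiv_fderiv h1]
  let L : EuclideanSpace ℝ (Fin n) →L[ℝ] EuclideanSpace ℝ (Fin n) := mfderiv (𝓡 n) (𝓡 n) e.symm p.1
  have hL : Function.Injective L := mfderiv_chart_symm_injective v.1 hp
  -- The vertical Hessian in coordinates is `g_{Ly}` pulled back by the injective map `L`, because
  -- the base point stays fixed.
  have hpos := F.posDef' (e.symm p.1) (L p.2) (L u)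
    (fun h => hp2 (hL (h.trans (map_zero L).symm))) (fun h => hu (hL (h.trans (map_zero L).symm)))
  have hfL : ∀ s t : ℝ, f (p + s • ((0, u) : EuclideanSpace ℝ (Fin n) × EuclideanSpace ℝ (Fin n))
      + t • ((0, u) : EuclideanSpace ℝ (Fin n) × EuclideanSpace ℝ (Fin n))) =
      F.toFun ⟨e.symm p.1, L p.2 + s • L u + t • L u⟩ := by
    intro s t
    have h2 : p + s • ((0, u) : EuclideanSpace ℝ (Fin n) × EuclideanSpace ℝ (Fin n))
      + t • ((0, u) : EuclideanSpace ℝ (Fin n) × EuclideanSpace ℝ (Fin n)) =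
        (p.1, p.2 + s • u + t • u) := by ext <;> simp
    have h3 : L p.2 + s • L u + t • L u = L (p.2 + s • u + t • u) := by
      simp only [map_add, map_smul]
    rw [h2]
    exact congrArg (fun z => F.toFun ⟨e.symm p.1, z⟩) h3.symm
  simp only [hfL, deriv_const_mul_field]
  exact hpos

/-- Existence of geodesics with given initial velocity. -/
theorem exists_isGeodesicOn (F : FinslerMetric n M) (v : TangentBundle (𝓡 n) M) (hv : v.2 ≠ 0) :
    ∃ (c : ℝ → M) (J : Set ℝ), F.IsGeodesicOn c J ∧ 0 ∈ J ∧ velocity n c 0 = v := by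
  have : IsManifold (𝓡 n) 1 M := IsManifold.of_le (n := ∞) (by simp)
  set e := chartAt (EuclideanSpace ℝ (Fin n)) v.1
  set f := F.inCoordinates e with hf
  let U : Set (EuclideanSpace ℝ (Fin n) × EuclideanSpace ℝ (Fin n)) := e.target ×ˢ {0}ᶜ
  have hU : IsOpen U := e.open_target.prod isOpen_compl_singleton
  have hG : ∀ p ∈ U, ContDiffAt ℝ ∞ (geodesicField f) p := fun p hp =>
    contDiffAt_geodesicField (F.contDiffAt_inCoordinates_chartAt v hp.1 hp.2)
      (F.det_coordMetric_inCoordinates_ne_zero v hp.1 hp.2)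
  have hx0 : v.1 ∈ e.source := mem_chart_source _ _
  let w := tangentMap (𝓡 n) (𝓡 n) e v
  have hwv : tangentMap (𝓡 n) (𝓡 n) e.symm w = v := by
    have h1 := tangentMap_chart_symm (I := 𝓡 n) (p := v) (q := w) (e.map_source hx0)
    refine h1.trans ?_
    have h2 := tangentMap_chart (I := 𝓡 n) (p := v) (q := v) hx0
    change (chartAt (ModelProd (EuclideanSpace ℝ (Fin n)) (EuclideanSpace ℝ (Fin n))) v).symm (Bundle.TotalSpace.toProd _ _ (tangentMap (𝓡 n) (𝓡 n) e v)) = v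
    rw [h2, Equiv.apply_symm_apply]
    exact (chartAt (ModelProd (EuclideanSpace ℝ (Fin n)) (EuclideanSpace ℝ (Fin n))) v).left_inv (mem_chart_source _ v)
  let p₀ : EuclideanSpace ℝ (Fin n) × EuclideanSpace ℝ (Fin n) := (w.1, w.2)
  have hp₀ : p₀ ∈ U := by
    refine ⟨e.map_source hx0, fun h => hv ?_⟩
    have h1 : w.2 = 0 := h
    rw [← hwv]
    change mfderiv (𝓡 n) (𝓡 n) e.symm w.1 w.2 = 0
    rw [h1, map_zero]
  -- Picard–Lindelöf; the interval is then shrunk so that the solution stays in the chart with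
  -- nonzero velocity.
  obtain ⟨α, hα0, ε, hε, hα⟩ :=
    ((hG p₀ hp₀).of_le (m := 1) (by simp)
      ).exists_forall_mem_closedBall_exists_eq_forall_mem_Ioo_hasDerivAt₀ 0
  have hαc : ContinuousAt α 0 := (hα 0 (by simpa using hε)).continuousAt
  obtain ⟨δ, hδ, hδU⟩ := Metric.eventually_nhds_iff_ball.1
    (hαc.eventually_mem (hU.mem_nhds (hα0 ▸ hp₀)))
  let J : Set ℝ := Set.Ioo (-min ε δ) (min ε δ)
  have hm : 0 < min ε δ := lt_min hε hδ
  have hJ : IsOpen J := isOpen_Ioo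
  have hJε : ∀ t ∈ J, HasDerivAt α (geodesicField f (α t)) t := fun t ht =>
    hα t ⟨by have := ht.1; have := min_le_left ε δ; linarith,
      by have := ht.2; have := min_le_left ε δ; linarith⟩
  have hJU : Set.MapsTo α J U := fun t ht => by
    apply hδU
    rw [Metric.mem_ball, dist_zero_right, Real.norm_eq_abs, abs_lt]
    exact ⟨by have := ht.1; have := min_le_right ε δ; linarith,
      by have := ht.2; have := min_le_right ε δ; linarith⟩
  have hαs : ContDiffOn ℝ ∞ α J :=
    contDiffOn_of_hasDerivAt_comp (fun p hp => (hG p hp).contDiffWithinAt) hJ hJU hJε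
  have hx : ∀ t ∈ J, HasDerivAt (fun s => (α s).1) (α t).2 t := fun t ht =>
    (ContinuousLinearMap.fst ℝ (EuclideanSpace ℝ (Fin n))
      (EuclideanSpace ℝ (Fin n))).hasFDerivAt.comp_hasDerivAt t (hJε t ht)
  have hy : ∀ t ∈ J, HasDerivAt (fun s => (α s).2) (geodesicField f (α t)).2 t := fun t ht =>
    (ContinuousLinearMap.snd ℝ (EuclideanSpace ℝ (Fin n))
      (EuclideanSpace ℝ (Fin n))).hasFDerivAt.comp_hasDerivAt t (hJε t ht)
  let c : ℝ → M := fun t => e.symm (α t).1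
  have hxs : ContMDiffOn 𝓘(ℝ, ℝ) (𝓡 n) ∞ (fun t => (α t).1) J := by
    exact (contDiff_fst.comp_contDiffOn hαs).contMDiffOn
  have hec : ∀ t ∈ J, e (c t) = (α t).1 := fun t ht => e.right_inv (hJU ht).1
  have hd1 : ∀ t ∈ J, deriv (fun r => e (c r)) t = (α t).2 := fun t ht => by
    rw [← (hx t ht).deriv]
    apply Filter.EventuallyEq.deriv_eq
    filter_upwards [hJ.mem_nhds ht] with r hr using hec r hr
  have hd2 : ∀ t ∈ J, deriv (deriv (fun r => e (c r))) t = (geodesicField f (α t)).2 :=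
    fun t ht => by
      rw [← (hy t ht).deriv]
      apply Filter.EventuallyEq.deriv_eq
      filter_upwards [hJ.mem_nhds ht] with r hr using hd1 r hr
  have hvel : ∀ t ∈ J, velocity n c t = tangentMap (𝓡 n) (𝓡 n) e.symm ⟨(α t).1, (α t).2⟩ := by
    intro t ht
    have h1 : HasMFDerivAt 𝓘(ℝ, ℝ) (𝓡 n) (fun s => (α s).1) t
        (ContinuousLinearMap.toSpanSingleton ℝ (α t).2) := (hx t ht).hasFDerivAt.hasMFDerivAt
    have h2 : MDifferentiableAt (𝓡 n) (𝓡 n) e.symm (α t).1 :=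
      mdifferentiableAt_atlas_symm (chart_mem_atlas _ _) (hJU ht).1
    have h3 := (HasMFDerivAt.comp (f := fun s => (α s).1) (g := e.symm) t
      h2.hasMFDerivAt h1).mfderiv
    unfold velocity tangentMap
    have h4 : mfderiv 𝓘(ℝ, ℝ) (𝓡 n) c t (1 : ℝ) =
        mfderiv (𝓡 n) (𝓡 n) e.symm (α t).1 (α t).2 := by
      have h5 := congrArg (fun L => L (1 : ℝ)) h3
      refine h5.trans ?_
      change mfderiv (𝓡 n) (𝓡 n) e.symm (α t).1 ((1 : ℝ) • (α t).2) = _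
      rw [one_smul]
    rw [h4]
  have h0 : (0 : ℝ) ∈ J := ⟨by simpa using hm, hm⟩
  refine ⟨c, J, ⟨hJ, Set.ordConnected_Ioo, ?_, ?_, ?_⟩, h0, ?_⟩
  · exact (contMDiffOn_chart_symm (I := 𝓡 n) (n := ∞)).comp hxs fun t ht => (hJU ht).1
  · intro t ht
    rw [hvel t ht]
    intro h
    exact (hJU ht).2 (mfderiv_chart_symm_injective v.1 (hJU ht).1 (h.trans (map_zero _).symm))
  · intro t ht
    -- The single chart at the initial point serves for all times in `J`.
    refine ⟨e, IsManifold.chart_mem_maximalAtlas _, e.map_target (hJU ht).1, fun i => ?_⟩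
    rw [hd1 t ht, hd2 t ht, hec t ht]
    simp [geodesicField, hf]
  · rw [hvel 0 h0, hα0]
    exact hwv

end FinslerMetric

end

theorem corollary5p3 {n : ℕ} {M : Type*} [TopologicalSpace M] [T2Space M]
    [SecondCountableTopology M] [ChartedSpace (EuclideanSpace ℝ (Fin n)) M]
    [IsManifold (𝓡 n) ∞ M] (F : FinslerMetric n M) (hF : F.IsGeodesicOrbit)
    (v : TangentBundle (𝓡 n) M) (hv : v.2 ≠ 0) :
    F.HasSCurvatureAt v 0 := by
  obtain ⟨G, hG, -, hgeod⟩ := hF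
  refine ⟨F.exists_isGeodesicOn v hv, fun c J hc h0 _ e => ?_⟩
  obtain ⟨φ, p, hφ, hp⟩ := hgeod c J hc
  exact F.hasDerivAt_distortion_of_orbit hG hφ hc h0 hp e
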